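/- Notation. Let $S_{\mathbb Z}$ be the group of permutations of $\mathbb Z$ fixing all but finitely many points, $S_\infty\subset S_{\mathbb Z}$ the subgroup of permutations with support in $\{1,2,3,\dots\}$, and $S_n\subset S_\infty$ the subgroup of those with support in $[n]=\{1,\dots,n\}$. Let $s_i=(i,i+1)$, and let $\ell(w)$ be the number of pairs of integers $i<j$ with $w(i)>w(j)$. On $\mathbb Z[x_1,x_2,\dots]$ let $\partial_i f=(f-s_if)/(x_i-x_{i+1})$, where $s_i$ exchanges $x_i$ and $x_{i+1}$. For $w\in S_\infty$ put $\partial_w=\partial_{i_1}\cdots\partial_{i_k}$, where $w=s_{i_1}\cdots s_{i_k}$ and $k=\ell(w)$; this does not depend on the chosen reduced word. Let $w_n\in S_n$ be the reverse permutation $i\mapsto n+1-i$ on $[n]$. The Schubert polynomial of $v\in S_n$ is $\mathfrak S_v=\partial_{v^{-1}w_n}(x_1^{n-1}x_2^{n-2}\cdots x_{n-1})$; it does not depend on the choice of $n$ with $v\in S_n$. Let $\Theta:\mathbb Z\to\mathbb Z$ be the permutation $i\mapsto i-(-1)^i$. For $z$ in the $S_\infty$-conjugacy class of $\Theta$, let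 $\mathcal A_{\mathrm{FPF}}(z)$ be the set of permutations $w\in S_{\mathbb Z}$ of minimal length such that $z=w^{-1}\Theta w$, and define $\hat{\mathfrak S}^{\mathrm{FPF}}_z=\sum_{w\in\mathcal A_{\mathrm{FPF}}(z)}\mathfrak S_w$. For $n$ even and $z\in S_n$ an involution with $z(i)\ne i$ for all $i\in[n]$, set $\hat{\mathfrak S}^{\mathrm{FPF}}_z=\hat{\mathfrak S}^{\mathrm{FPF}}_{\iota(z)}$, where $\iota(z)$ is the permutation of $\mathbb Z$ that agrees with $z$ on $[n]$ and with $\Theta$ on $\mathbb Z\setminus[n]$. Statement. For every even positive integer $n$, $$\hat{\mathfrak S}^{\mathrm{FPF}}_{w_n}=\prod_{\substack{1\le i<j\le n\\ i+j\le n}}(x_i+x_j).$$ -/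

import Mathlib

/-! ### Permutations of the integers -/

/-- The group `S_ℤ` of permutations of `ℤ` which fix all but finitely many points. -/
def SInt : Set (Equiv.Perm ℤ) := {w | {i : ℤ | w i ≠ i}.Finite}

/-- `S_∞`: the elements of `S_ℤ` whose support is contained in `{1, 2, 3, …}`. -/
def SInfty : Set (Equiv.Perm ℤ) := {w | w ∈ SInt ∧ ∀ i : ℤ, w i ≠ i → 1 ≤ i}

/-- `S_n`: the permutations which fix all integers outside `[n] = {1, …, n}`. -/
def SFin (n : ℕ+) : Set (Equiv.Perm ℤ) := {w | ∀ i : ℤ, w i ≠ i → 1 ≤ i ∧ i ≤ (n : ℤ)}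

/-- Every element of `S_∞` lies in some `S_n`. -/
theorem exists_mem_SFin {w : Equiv.Perm ℤ} (hw : w ∈ SInfty) : ∃ n : ℕ+, w ∈ SFin n := by
  obtain ⟨hfin, hpos⟩ := hw
  obtain ⟨M, hM⟩ := Set.Finite.bddAbove (show {i : ℤ | w i ≠ i}.Finite from hfin)
  refine ⟨⟨M.toNat + 1, Nat.succ_pos _⟩, fun i hi => ⟨hpos i hi, ?_⟩⟩
  have h1 : i ≤ M := hM hi
  have h2 := Int.self_le_toNat M
  push_cast [PNat.mk_coe]
  omega

/-- The simple transposition `s_i = (i, i + 1)`. -/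
def simpleTransposition (i : ℤ) : Equiv.Perm ℤ := Equiv.swap i (i + 1)

/-- The length `ℓ(w)`: the number of inversions `(i, j)`, `i < j`, `w(i) > w(j)`. It is used only
for `w ∈ S_ℤ`, where there are finitely many inversions. -/
noncomputable def permLength (w : Equiv.Perm ℤ) : ℕ :=
  Set.ncard {p : ℤ × ℤ | p.1 < p.2 ∧ w p.2 < w p.1}

/-- `l = [i₁, …, i_k]` encodes a reduced word for `w ∈ S_∞`:
`w = s_{i₁} ⋯ s_{i_k}` with `k = ℓ(w)`. -/
def IsReducedWord (l : List ℕ+) (w : Equiv.Perm ℤ) : Prop :=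
  (l.map fun i : ℕ+ => simpleTransposition (i : ℤ)).prod = w ∧ l.length = permLength w

/-- The reverse permutation `w_n = n ⋯ 3 2 1 ∈ S_n`, as a permutation of `ℤ`. -/
def reversePerm (n : ℕ+) : Equiv.Perm ℤ :=
  Function.Involutive.toPerm
    (fun i : ℤ => if 1 ≤ i ∧ i ≤ (n : ℤ) then (n : ℤ) + 1 - i else i) (by
      intro i
      dsimp only
      split_ifs <;> omega)

/-! ### Divided differences and Schubert polynomials in `ℤ[x₁, x₂, …]` -/

/-- The action of `s_i` on polynomials, exchanging the variables `x_i` and `x_{i+1}`. -/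
noncomputable def swapVars (i : ℕ+) (f : MvPolynomial ℕ+ ℤ) : MvPolynomial ℕ+ ℤ :=
  MvPolynomial.rename (Equiv.swap i (i + 1)) f

theorem sub_dvd_sub_swapVars (i : ℕ+) (f : MvPolynomial ℕ+ ℤ) :
    (MvPolynomial.X i - MvPolynomial.X (i + 1) : MvPolynomial ℕ+ ℤ) ∣ f - swapVars i f := by
  induction f using MvPolynomial.induction_on with
  | C a => simp [swapVars]
  | add p q hp hq =>
    have h : p + q - swapVars i (p + q) = (p - swapVars i p) + (q - swapVars i q) := by
      simp only [swapVars, map_add]; ring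
    rw [h]
    exact dvd_add hp hq
  | mul_X p j hp =>
    have h : p * MvPolynomial.X j - swapVars i (p * MvPolynomial.X j)
        = (p - swapVars i p) * MvPolynomial.X j
          + swapVars i p * (MvPolynomial.X j - MvPolynomial.X (Equiv.swap i (i + 1) j)) := by
      simp only [swapVars, map_mul, MvPolynomial.rename_X]; ring
    rw [h]
    refine dvd_add (hp.mul_right _) (Dvd.dvd.mul_left ?_ _)
    by_cases h1 : j = i
    · subst h1
      rw [Equiv.swap_apply_left]
    · by_cases h2 : j = i + 1
      · subst h2
        rw [Equiv.swap_apply_right]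
        exact ⟨-1, by ring⟩
      · rw [Equiv.swap_apply_of_ne_of_ne h1 h2, sub_self]
        exact dvd_zero _

/-- The divided difference `∂_i f = (f - s_i f) / (x_i - x_{i+1})`. -/
noncomputable def dividedDifference (i : ℕ+) (f : MvPolynomial ℕ+ ℤ) : MvPolynomial ℕ+ ℤ :=
  (sub_dvd_sub_swapVars i f).choose

/-- The defining equation of `∂_i f`, which determines it since `ℤ[x₁, x₂, …]` is a domain. -/
theorem dividedDifference_spec (i : ℕ+) (f : MvPolynomial ℕ+ ℤ) :
    f - swapVars i f =
      (MvPolynomial.X i - MvPolynomial.X (i + 1)) * dividedDifference i f :=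
  (sub_dvd_sub_swapVars i f).choose_spec

open Classical in
/-- The operator `∂_w = ∂_{i₁} ⋯ ∂_{i_k}` for `w ∈ S_∞`, where `(s_{i₁}, …, s_{i_k})` is any reduced
word for `w`. The value `0` is taken only for permutations without a reduced word in
`s_1, s_2, …`, that is, outside `S_∞`. -/
noncomputable def dividedDifferencePerm (w : Equiv.Perm ℤ) (f : MvPolynomial ℕ+ ℤ) :
    MvPolynomial ℕ+ ℤ :=
  if h : ∃ l : List ℕ+, IsReducedWord l w then h.choose.foldr dividedDifference f else 0

/-- The monomial `x^{δ_n} = x_1^{n-1} x_2^{n-2} ⋯ x_{n-1}`. -/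
noncomputable def staircaseMonomial (n : ℕ+) : MvPolynomial ℕ+ ℤ :=
  ∏ i ∈ Finset.Icc 1 n, MvPolynomial.X i ^ ((n : ℕ) - (i : ℕ))

open Classical in
/-- The Schubert polynomial `𝔖_v = ∂_{v⁻¹ w_n} x^{δ_n}` of `v ∈ S_∞`, for any `n` with `v ∈ S_n`;
by convention `𝔖_v = 0` if `v ∉ S_∞`. -/
noncomputable def schubert (v : Equiv.Perm ℤ) : MvPolynomial ℕ+ ℤ :=
  if h : v ∈ SInfty then
    dividedDifferencePerm (v⁻¹ * reversePerm (exists_mem_SFin h).choose)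
      (staircaseMonomial (exists_mem_SFin h).choose)
  else 0

/-! ### Fixed-point-free involutions -/

/-- The permutation `Θ : i ↦ i - (-1)^i` of `ℤ`. -/
def thetaPerm : Equiv.Perm ℤ :=
  Function.Involutive.toPerm (fun i : ℤ => if Even i then i - 1 else i + 1) (by
    intro i
    dsimp only
    simp only [Int.even_iff]
    split_ifs <;> omega)

theorem thetaPerm_apply (i : ℤ) : thetaPerm i = i - (i.negOnePow : ℤ) := by
  change (if Even i then i - 1 else i + 1) = _
  split_ifs with h
  · simp [Int.negOnePow_even i h]
  · simp [Int.negOnePow_odd i (Int.not_even_iff_odd.mp h)]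

/-- `F_n`: the involutions in `S_n` without fixed points in `[n]`. -/
def FPFInvolutions (n : ℕ+) : Set (Equiv.Perm ℤ) :=
  {z | z ∈ SFin n ∧ z * z = 1 ∧ ∀ i : ℤ, 1 ≤ i → i ≤ (n : ℤ) → z i ≠ i}

theorem reversePerm_mem_FPFInvolutions (n : ℕ+) (hn : Even (n : ℕ)) :
    reversePerm n ∈ FPFInvolutions n := by
  have happ : ∀ i : ℤ, reversePerm n i =
      if 1 ≤ i ∧ i ≤ (n : ℤ) then (n : ℤ) + 1 - i else i := fun i => rfl
  refine ⟨fun i hi => ?_, ?_, fun i h1 h2 => ?_⟩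
  · by_contra h
    exact hi (by rw [happ, if_neg h])
  · ext i
    rw [Equiv.Perm.mul_apply, happ (reversePerm n i), happ i, Equiv.Perm.one_apply]
    split_ifs <;> omega
  · rw [happ, if_pos ⟨h1, h2⟩]
    obtain ⟨m, hm⟩ := hn
    have : ((n : ℕ) : ℤ) = m + m := by exact_mod_cast hm
    omega

/-- The inclusion `ι : F_n → F_∞`, for even `n`: the permutation `ι(z)` of `ℤ` agrees with `z`
on `[n]` and with `Θ` on `ℤ ∖ [n]`. -/
def fpfEmbed (n : ℕ+) (hn : Even (n : ℕ)) (z : Equiv.Perm ℤ) (hz : z ∈ FPFInvolutions n) :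
    Equiv.Perm ℤ :=
  Function.Involutive.toPerm
    (fun i : ℤ => if 1 ≤ i ∧ i ≤ (n : ℤ) then z i else thetaPerm i) (by
      obtain ⟨hS, hinv, hfpf⟩ := hz
      have hzz : ∀ i, z (z i) = i := fun i => by
        rw [← Equiv.Perm.mul_apply, hinv, Equiv.Perm.one_apply]
      have hth : ∀ i, thetaPerm i = if Even i then i - 1 else i + 1 := fun i => rfl
      have htt : ∀ i, thetaPerm (thetaPerm i) = i :=
        Function.Involutive.toPerm_involutive _
      obtain ⟨m, hm⟩ := hn
      have hm' : ((n : ℕ) : ℤ) = m + m := by exact_mod_cast hm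
      intro i
      dsimp only
      by_cases hi : 1 ≤ i ∧ i ≤ (n : ℤ)
      · have hzi : 1 ≤ z i ∧ z i ≤ (n : ℤ) := by
          apply hS
          rw [hzz]
          exact (hfpf i hi.1 hi.2).symm
        rw [if_pos hi, if_pos hzi, hzz]
      · have hti : ¬ (1 ≤ thetaPerm i ∧ thetaPerm i ≤ (n : ℤ)) := by
          rw [hth]
          split_ifs with he
          · obtain ⟨k, hk⟩ := he
            omega
          · obtain ⟨k, hk⟩ := Int.not_even_iff_odd.mp he
            omega
        rw [if_neg hi, if_neg hti, htt])

/-- `A_FPF(z)`: the permutations `w ∈ S_ℤ` of minimal length such that `z = w⁻¹ Θ w`. -/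
def fpfAtoms (z : Equiv.Perm ℤ) : Set (Equiv.Perm ℤ) :=
  {w | w ∈ SInt ∧ z = w⁻¹ * thetaPerm * w ∧
    ∀ v ∈ SInt, z = v⁻¹ * thetaPerm * v → permLength w ≤ permLength v}

/-- The fixed-point-free involution Schubert polynomial `∑_{w ∈ A_FPF(z)} 𝔖_w`, for `z` in the
`S_∞`-conjugacy class of `Θ`. -/
noncomputable def fpfSchubert (z : Equiv.Perm ℤ) : MvPolynomial ℕ+ ℤ :=
  ∑ᶠ w ∈ fpfAtoms z, schubert w

open MvPolynomial

/-! ### Homogeneity of divided differences -/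

/-! A homogeneous polynomial of degree `d` in infinitely many variables is determined by the
constants `∂_l f`, with `l` running over all words of length `d`, reduced or not
(`eq_zero_of_forall_dividedDifferenceWord`). So it suffices to compare these constants for the two
sides, `d` being the number of pairs `i < j` with `i + j ≤ n`.

The constants come from localization (`eval_dividedDifferenceWord_mul`): if `f` vanishes at `y ∘ u`
for every `u` of length less than `|l|`, then `(∂_l f)(y)` times the product of `y(v a) - y(v b)`
over the inversions `(a, b)` of `v = wordProd l` equals `f(y ∘ v)`. Suppose that, whenever `f(y ∘ u)
≠ 0`, the linear factors of `f` at `y ∘ u` match distinct inversions of `u`. Then the vanishing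
hypothesis is a count of inversions, and for `|l|` equal to the number of factors `∂_l f` is 1 or 0
according to whether `f(y ∘ v) ≠ 0`.

This is used twice. For `∏ (x_i - j)`, with leading term `x^{δ_n}`, at `y = id`, only `w_n`
survives; hence `∂_l 𝔖_w` is 1 if `wordProd l = w` and 0 otherwise, for `|l| = ℓ(w)`. For `∏ (x_i +
x_j)`, take `y` with `y(Θ i) = -y(i)`: with `z = u⁻¹Θu`, the factor `y(u i) + y(u j)` equals `y(u j)
- y(u (z i))`, a difference attached to a pair of positions. The surviving `u` are those with `z =
ι(w_n)` (`thetaConj_eq_and_mem_SFin`), that is, the atoms in `S_∞`. Both sides thus have the same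
constants. -/

theorem homogeneousComponent_add_mul {σ R : Type*} [CommSemiring R] {m : ℕ}
    {p : MvPolynomial σ R} (hp : p.IsHomogeneous m) (n : ℕ) (q : MvPolynomial σ R) :
    homogeneousComponent (m + n) (p * q) = p * homogeneousComponent n q := by
  conv_lhs => rw [← sum_homogeneousComponent q, Finset.mul_sum, map_sum]
  have h : ∀ k, homogeneousComponent (m + n) (p * homogeneousComponent k q) =
      if k = n then p * homogeneousComponent n q else 0 := by
    intro k
    rw [homogeneousComponent_of_mem (hp.mul (homogeneousComponent_isHomogeneous k q))]
    by_cases hk : k = n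
    · simp [hk]
    · rw [if_neg (by omega), if_neg hk]
  simp only [h, Finset.sum_ite_eq']
  split_ifs with hn
  · rfl
  · rw [homogeneousComponent_eq_zero n q (by simpa using hn), mul_zero]

theorem isHomogeneous_of_mul {σ R : Type*} [CommRing R] [IsDomain R] {m n : ℕ}
    {p q : MvPolynomial σ R} (hp : p.IsHomogeneous m) (hp0 : p ≠ 0)
    (h : (p * q).IsHomogeneous (m + n)) : q.IsHomogeneous n := by
  have h1 : p * homogeneousComponent n q = p * q := by
    rw [← homogeneousComponent_add_mul hp, homogeneousComponent_of_mem h, if_pos rfl]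
  rw [← mul_left_cancel₀ hp0 h1]
  exact homogeneousComponent_isHomogeneous n q

theorem X_sub_X_succ_ne_zero (i : ℕ+) : (X i - X (i + 1) : MvPolynomial ℕ+ ℤ) ≠ 0 := by
  rw [sub_ne_zero]
  intro h
  have := congrArg PNat.val (X_injective h)
  simp at this

theorem dividedDifference_eq_of_mul_eq {i : ℕ+} {f g : MvPolynomial ℕ+ ℤ}
    (h : f - swapVars i f = (X i - X (i + 1)) * g) : dividedDifference i f = g :=
  mul_left_cancel₀ (X_sub_X_succ_ne_zero i) (by rw [← dividedDifference_spec, h])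

theorem dividedDifference_add (i : ℕ+) (f g : MvPolynomial ℕ+ ℤ) :
    dividedDifference i (f + g) = dividedDifference i f + dividedDifference i g := by
  apply dividedDifference_eq_of_mul_eq
  rw [mul_add, ← dividedDifference_spec, ← dividedDifference_spec]
  simp only [swapVars, map_add]
  ring

/-- The operator `∂_{i₁} ⋯ ∂_{i_k}` attached to a word. -/
noncomputable def dividedDifferenceWord (l : List ℕ+) : MvPolynomial ℕ+ ℤ →+ MvPolynomial ℕ+ ℤ :=
  l.foldr (fun i g => (AddMonoidHom.mk' (dividedDifference i) (dividedDifference_add i)).comp g)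
    (AddMonoidHom.id _)

theorem dividedDifferenceWord_nil (f : MvPolynomial ℕ+ ℤ) : dividedDifferenceWord [] f = f := rfl

theorem dividedDifferenceWord_cons (i : ℕ+) (l : List ℕ+) (f : MvPolynomial ℕ+ ℤ) :
    dividedDifferenceWord (i :: l) f = dividedDifference i (dividedDifferenceWord l f) := rfl

theorem dividedDifferenceWord_eq_foldr (l : List ℕ+) (f : MvPolynomial ℕ+ ℤ) :
    dividedDifferenceWord l f = l.foldr dividedDifference f := by
  induction l with
  | nil => rfl
  | cons i l ih => rw [dividedDifferenceWord_cons, ih, List.foldr_cons]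

theorem dividedDifferenceWord_append (l₁ l₂ : List ℕ+) (f : MvPolynomial ℕ+ ℤ) :
    dividedDifferenceWord (l₁ ++ l₂) f =
      dividedDifferenceWord l₁ (dividedDifferenceWord l₂ f) := by
  simp only [dividedDifferenceWord_eq_foldr, List.foldr_append]

theorem isHomogeneous_dividedDifference {i : ℕ+} {f : MvPolynomial ℕ+ ℤ} {n : ℕ}
    (hf : f.IsHomogeneous (1 + n)) : (dividedDifference i f).IsHomogeneous n := by
  refine isHomogeneous_of_mul ((isHomogeneous_X ℤ i).sub (isHomogeneous_X ℤ (i + 1)))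
    (X_sub_X_succ_ne_zero i) ?_
  rw [← dividedDifference_spec]
  exact hf.sub hf.rename_isHomogeneous

theorem isHomogeneous_dividedDifferenceWord {l : List ℕ+} {f : MvPolynomial ℕ+ ℤ} {n : ℕ}
    (hf : f.IsHomogeneous (l.length + n)) : (dividedDifferenceWord l f).IsHomogeneous n := by
  induction l generalizing n with
  | nil => simpa [dividedDifferenceWord_nil] using hf
  | cons i l ih =>
    rw [dividedDifferenceWord_cons]
    apply isHomogeneous_dividedDifference
    apply ih
    convert hf using 1
    simp only [List.length_cons]
    ring

theorem dividedDifference_eq_zero_or (i : ℕ+) (f : MvPolynomial ℕ+ ℤ) :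
    dividedDifference i f = 0 ∨ (dividedDifference i f).totalDegree + 1 ≤ f.totalDegree := by
  by_cases h : dividedDifference i f = 0
  · exact Or.inl h
  right
  have h1 : (X i - X (i + 1) : MvPolynomial ℕ+ ℤ).totalDegree = 1 :=
    ((isHomogeneous_X ℤ i).sub (isHomogeneous_X ℤ (i + 1))).totalDegree (X_sub_X_succ_ne_zero i)
  have h2 := totalDegree_mul_of_isDomain (X_sub_X_succ_ne_zero i) h
  rw [← dividedDifference_spec, h1] at h2
  have h3 := totalDegree_sub f (swapVars i f)
  have h4 : (swapVars i f).totalDegree ≤ f.totalDegree := totalDegree_rename_le _ _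
  rw [max_eq_left h4] at h3
  omega

/-- Each `∂_i` kills its argument or lowers the total degree. This allows lower-order terms to be
added to a polynomial without changing its top divided differences. -/
theorem dividedDifferenceWord_eq_zero_of_totalDegree_lt {l : List ℕ+} {f : MvPolynomial ℕ+ ℤ}
    (h : f.totalDegree < l.length) : dividedDifferenceWord l f = 0 := by
  have key : ∀ l : List ℕ+, dividedDifferenceWord l f = 0 ∨
      (dividedDifferenceWord l f).totalDegree + l.length ≤ f.totalDegree := by
    intro l
    induction l with
    | nil => right; simp [dividedDifferenceWord_nil]
    | cons i l ih =>
      rw [dividedDifferenceWord_cons]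
      rcases dividedDifference_eq_zero_or i (dividedDifferenceWord l f) with h0 | h0
      · exact Or.inl h0
      · rcases ih with h1 | h1
        · rw [h1, totalDegree_zero] at h0
          omega
        · right
          rw [List.length_cons]
          omega
  rcases key l with h0 | h0
  · exact h0
  · omega

/-- There is no last variable: if `x_i` is the largest one occurring in `f`, symmetry under `s_i`
makes `x_{i+1}` occur as well. -/
theorem eq_zero_of_forall_swapVars {f : MvPolynomial ℕ+ ℤ} {n : ℕ} (hf : f.IsHomogeneous (n + 1))
    (h : ∀ i, swapVars i f = f) : f = 0 := by
  by_contra hne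
  have hv : f.vars.Nonempty := by
    rw [Finset.nonempty_iff_ne_empty, Ne, vars_eq_empty_iff_eq_C]
    intro hC
    have h1 := hf.totalDegree hne
    rw [hC, totalDegree_C] at h1
    omega
  have hmax := f.vars.max'_mem hv
  set i := f.vars.max' hv with hi
  have h1 : i + 1 ∈ f.vars := by
    rw [← h i, swapVars] at hmax
    obtain ⟨k, hk, hki⟩ := mem_vars_rename _ _ hmax
    rw [Equiv.swap_apply_eq_iff, Equiv.swap_apply_left] at hki
    rwa [← hki]
  have h2 : i + 1 ≤ i := f.vars.le_max' _ h1
  exact absurd h2 (not_le.2 (PNat.lt_add_right i 1))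

theorem eq_zero_of_forall_dividedDifferenceWord {n : ℕ} {f : MvPolynomial ℕ+ ℤ}
    (hf : f.IsHomogeneous n)
    (h : ∀ l : List ℕ+, l.length = n → dividedDifferenceWord l f = 0) : f = 0 := by
  induction n generalizing f with
  | zero => exact h [] rfl
  | succ n ih =>
    refine eq_zero_of_forall_swapVars hf fun i => ?_
    have h0 : dividedDifference i f = 0 := by
      refine ih (isHomogeneous_dividedDifference (by rwa [add_comm])) fun l hl => ?_
      -- The last letter of a word acts first, so `∂_i f` inherits the hypothesis for words one
      -- letter shorter.
      have := h (l ++ [i]) (by simp [hl])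
      rwa [dividedDifferenceWord_append] at this
    have h1 := dividedDifference_spec i f
    rw [h0, mul_zero, sub_eq_zero] at h1
    exact h1.symm

/-! ### Inversions -/

/-- The set of inversions of a permutation of `ℤ`. -/
def inversions (w : Equiv.Perm ℤ) : Set (ℤ × ℤ) := {p | p.1 < p.2 ∧ w p.2 < w p.1}

theorem mem_inversions {w : Equiv.Perm ℤ} {a b : ℤ} :
    (a, b) ∈ inversions w ↔ a < b ∧ w b < w a := Iff.rfl

theorem perm_apply_inv_apply {α : Type*} (w : Equiv.Perm α) (i : α) : w (w⁻¹ i) = i :=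
  w.apply_symm_apply i

theorem perm_inv_apply_apply {α : Type*} (w : Equiv.Perm α) (i : α) : w⁻¹ (w i) = i :=
  w.symm_apply_apply i

theorem permLength_eq_ncard (w : Equiv.Perm ℤ) : permLength w = (inversions w).ncard := rfl

theorem inversions_finite {w : Equiv.Perm ℤ} (hw : w ∈ SInt) : (inversions w).Finite := by
  have hw' : {i : ℤ | w i ≠ i}.Finite := hw
  obtain ⟨M, hM⟩ := hw'.bddAbove
  obtain ⟨m, hm⟩ := hw'.bddBelow
  refine ((Set.finite_Icc m M).prod (Set.finite_Icc m M)).subset ?_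
  rintro ⟨a, b⟩ ⟨h1, h2⟩
  have hM' : ∀ i, w i ≠ i → i ≤ M := fun i hi => hM hi
  have hm' : ∀ i, w i ≠ i → m ≤ i := fun i hi => hm hi
  have hww : ∀ i, w i ≠ i → w (w i) ≠ w i := fun i hi h => hi (w.injective h)
  dsimp only at h1 h2
  simp only [Set.mem_prod, Set.mem_Icc]
  by_cases ha : w a = a
  · have hb : w b ≠ b := by omega
    have := hM' b hb
    have := hm' (w b) (hww b hb)
    omega
  · by_cases hb : w b = b
    · have := hm' a ha
      have := hM' (w a) (hww a ha)
      omega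
    · exact ⟨⟨hm' a ha, hM' a ha⟩, hm' b hb, hM' b hb⟩

theorem one_mem_SInfty : (1 : Equiv.Perm ℤ) ∈ SInfty := by
  refine ⟨?_, fun i hi => absurd rfl hi⟩
  simp [SInt]

theorem mul_mem_SInfty {v w : Equiv.Perm ℤ} (hv : v ∈ SInfty) (hw : w ∈ SInfty) :
    v * w ∈ SInfty := by
  have key : ∀ i, (v * w) i ≠ i → v i ≠ i ∨ w i ≠ i := by
    intro i hi
    by_contra! h
    exact hi (by rw [Equiv.Perm.mul_apply, h.2, h.1])
  refine ⟨(Set.Finite.union hv.1 hw.1).subset key, fun i hi => ?_⟩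
  rcases key i hi with h | h
  · exact hv.2 i h
  · exact hw.2 i h

theorem inv_mem_SInfty {w : Equiv.Perm ℤ} (hw : w ∈ SInfty) : w⁻¹ ∈ SInfty := by
  have key : ∀ i, w⁻¹ i ≠ i → w i ≠ i := fun i hi h => hi (Equiv.Perm.inv_eq_iff_eq.2 h.symm)
  exact ⟨Set.Finite.subset hw.1 key, fun i hi => hw.2 i (key i hi)⟩

theorem simpleTransposition_mem_SInfty (i : ℕ+) : simpleTransposition (i : ℤ) ∈ SInfty := by
  have key : ∀ j, simpleTransposition (i : ℤ) j ≠ j → j = i ∨ j = i + 1 := by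
    intro j hj
    by_contra! h
    exact hj (Equiv.swap_apply_of_ne_of_ne h.1 h.2)
  have hi := i.pos
  refine ⟨(Set.toFinite {(i : ℤ), (i : ℤ) + 1}).subset key, fun j hj => ?_⟩
  rcases key j hj with rfl | rfl <;> omega

theorem mem_SInfty_of_mem_SFin {n : ℕ+} {w : Equiv.Perm ℤ} (hw : w ∈ SFin n) : w ∈ SInfty :=
  ⟨(Set.finite_Icc (1 : ℤ) n).subset fun i hi => hw i hi, fun i hi => (hw i hi).1⟩

theorem one_le_apply {w : Equiv.Perm ℤ} (hw : w ∈ SInfty) {i : ℤ} (hi : 1 ≤ i) : 1 ≤ w i := by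
  by_cases h : w i = i
  · omega
  · exact hw.2 _ fun h' => h (w.injective h')

theorem apply_of_nonpos {w : Equiv.Perm ℤ} (hw : w ∈ SInfty) {i : ℤ} (hi : i < 1) : w i = i := by
  by_contra h
  have := hw.2 i h
  omega

/-- The product of the simple transpositions indexed by the letters of a word. -/
def wordProd (l : List ℕ+) : Equiv.Perm ℤ :=
  (l.map fun i : ℕ+ => simpleTransposition (i : ℤ)).prod

theorem wordProd_cons (i : ℕ+) (l : List ℕ+) :
    wordProd (i :: l) = simpleTransposition (i : ℤ) * wordProd l := by
  simp [wordProd]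

theorem wordProd_append (l₁ l₂ : List ℕ+) :
    wordProd (l₁ ++ l₂) = wordProd l₁ * wordProd l₂ := by
  simp [wordProd]

theorem wordProd_mem_SInfty (l : List ℕ+) : wordProd l ∈ SInfty := by
  induction l with
  | nil => exact one_mem_SInfty
  | cons i l ih => rw [wordProd_cons]; exact mul_mem_SInfty (simpleTransposition_mem_SInfty i) ih

/-- Exchanging the adjacent values `i` and `i + 1` changes the relative order of no other pair of
positions. -/
theorem inversions_simpleTransposition_mul {i : ℤ} {w : Equiv.Perm ℤ}
    (h : w⁻¹ i < w⁻¹ (i + 1)) :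
    inversions (simpleTransposition i * w) =
      insert (w⁻¹ i, w⁻¹ (i + 1)) (inversions w) := by
  ext ⟨a, b⟩
  obtain ⟨A, rfl⟩ : ∃ A, a = w⁻¹ A := ⟨w a, (perm_inv_apply_apply w a).symm⟩
  obtain ⟨B, rfl⟩ : ∃ B, b = w⁻¹ B := ⟨w b, (perm_inv_apply_apply w b).symm⟩
  have hinj : ∀ x y, w⁻¹ x = w⁻¹ y ↔ x = y := fun x y => (w⁻¹).injective.eq_iff
  simp only [mem_inversions, Set.mem_insert_iff, Prod.mk.injEq, hinj,
    Equiv.Perm.mul_apply, perm_apply_inv_apply, simpleTransposition]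
  by_cases hAi : A = i
  · subst hAi
    rw [Equiv.swap_apply_left]
    by_cases hBi : B = A + 1
    · subst hBi
      rw [Equiv.swap_apply_right]
      simpa using h
    · by_cases hBA : B = A
      · subst hBA; simp
      · rw [Equiv.swap_apply_of_ne_of_ne hBA hBi]
        omega
  · by_cases hAi' : A = i + 1
    · subst hAi'
      rw [Equiv.swap_apply_right]
      by_cases hBi : B = i
      · subst hBi
        rw [Equiv.swap_apply_left]
        omega
      · by_cases hBA : B = i + 1
        · subst hBA; simp
        · rw [Equiv.swap_apply_of_ne_of_ne hBi hBA]
          omega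
    · rw [Equiv.swap_apply_of_ne_of_ne hAi hAi']
      by_cases hBi : B = i
      · subst hBi
        rw [Equiv.swap_apply_left]
        omega
      · by_cases hBA : B = i + 1
        · subst hBA
          rw [Equiv.swap_apply_right]
          omega
        · rw [Equiv.swap_apply_of_ne_of_ne hBi hBA]
          omega

theorem notMem_inversions {i : ℤ} {w : Equiv.Perm ℤ} :
    (w⁻¹ i, w⁻¹ (i + 1)) ∉ inversions w := by
  rintro ⟨-, h⟩
  simp only [perm_apply_inv_apply] at h
  omega

theorem simpleTransposition_mul_self_mul (i : ℤ) (w : Equiv.Perm ℤ) :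
    simpleTransposition i * (simpleTransposition i * w) = w := by
  rw [← mul_assoc, simpleTransposition, Equiv.swap_mul_self, one_mul]

theorem permLength_simpleTransposition_mul {i : ℤ} {w : Equiv.Perm ℤ} (hw : w ∈ SInt)
    (h : w⁻¹ i < w⁻¹ (i + 1)) :
    permLength (simpleTransposition i * w) = permLength w + 1 := by
  rw [permLength_eq_ncard, permLength_eq_ncard, inversions_simpleTransposition_mul h,
    Set.ncard_insert_of_notMem notMem_inversions (inversions_finite hw)]

theorem simpleTransposition_mul_inv_lt {i : ℤ} {w : Equiv.Perm ℤ} (h : ¬ w⁻¹ i < w⁻¹ (i + 1)) :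
    (simpleTransposition i * w)⁻¹ i < (simpleTransposition i * w)⁻¹ (i + 1) := by
  have h1 : (simpleTransposition i)⁻¹ = simpleTransposition i := Equiv.swap_inv _ _
  rw [mul_inv_rev, h1, Equiv.Perm.mul_apply, Equiv.Perm.mul_apply, simpleTransposition,
    Equiv.swap_apply_left, Equiv.swap_apply_right]
  refine lt_of_le_of_ne (not_lt.1 h) fun h' => ?_
  have := (w⁻¹).injective h'
  omega

theorem permLength_simpleTransposition_mul_le (i : ℕ+) {w : Equiv.Perm ℤ} (hw : w ∈ SInfty) :
    permLength (simpleTransposition i * w) ≤ permLength w + 1 := by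
  by_cases h : w⁻¹ (i : ℤ) < w⁻¹ (i + 1)
  · exact (permLength_simpleTransposition_mul hw.1 h).le
  · have := permLength_simpleTransposition_mul
      (mul_mem_SInfty (simpleTransposition_mem_SInfty i) hw).1 (simpleTransposition_mul_inv_lt h)
    rw [simpleTransposition_mul_self_mul] at this
    omega

theorem permLength_one : permLength 1 = 0 := by
  have : inversions 1 = ∅ := by
    ext ⟨a, b⟩
    simp only [mem_inversions, Equiv.Perm.one_apply, Set.mem_empty_iff_false, iff_false]
    omega
  rw [permLength_eq_ncard, this, Set.ncard_empty]

theorem permLength_wordProd_le (l : List ℕ+) : permLength (wordProd l) ≤ l.length := by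
  induction l with
  | nil => exact permLength_one.le
  | cons i l ih =>
    rw [wordProd_cons, List.length_cons]
    have := permLength_simpleTransposition_mul_le i (wordProd_mem_SInfty l)
    omega

/-- Downward induction from the top of the support: once everything above `i` is fixed, a value `i`
taken at an earlier position would force `w i > i`, already the value at a fixed point. -/
theorem apply_eq_self_of_inversions {w : Equiv.Perm ℤ} (hw : w ∈ SInt) {n : ℤ}
    (h : ∀ p ∈ inversions w, p.2 ≤ n) {i : ℤ} (hi : n < i) : w i = i := by
  obtain ⟨M, hM⟩ := (show {i : ℤ | w i ≠ i}.Finite from hw).bddAbove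
  have hM' : ∀ i, w i ≠ i → i ≤ M := fun i hi => hM hi
  have key : ∀ k : ℕ, ∀ i, n < i → M < i + k → w i = i := by
    intro k
    induction k with
    | zero =>
      intro i _ h2
      by_contra h3
      have := hM' i h3
      omega
    | succ k ih =>
      intro i h1 h2
      have hfix : ∀ j, i < j → w j = j := fun j hj => ih j (by omega) (by push_cast at h2; omega)
      obtain ⟨c, hc⟩ := w.surjective i
      rcases lt_trichotomy c i with h3 | h3 | h3
      · have h4 : w c < w i := by
          rcases lt_trichotomy (w c) (w i) with h5 | h5 | h5
          · exact h5
          · exact absurd (w.injective h5) h3.ne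
          · have := h (c, i) ⟨h3, h5⟩
            simp only at this
            omega
        rw [hc] at h4
        exact w.injective (hfix _ h4)
      · rw [← h3, hc, h3]
      · have := hfix c h3
        omega
  exact key (M + 1 - i).toNat i hi (by omega)

theorem exists_isReducedWord {w : Equiv.Perm ℤ} (hw : w ∈ SInfty) :
    ∃ l : List ℕ+, IsReducedWord l w := by
  induction hk : permLength w generalizing w with
  | zero =>
    refine ⟨[], ?_, by rw [hk]; rfl⟩
    have h0 : inversions w = ∅ := by
      rw [permLength_eq_ncard, Set.ncard_eq_zero (inversions_finite hw.1)] at hk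
      exact hk
    ext i
    by_cases hi : i < 1
    · simp [apply_of_nonpos hw hi]
    · simp [apply_eq_self_of_inversions hw.1 (n := 0) (by simp [h0]) (by omega : 0 < i)]
  | succ k ih =>
    -- Without a left descent, `w⁻¹` is increasing on the positive integers, hence trivial;
    -- otherwise a left descent is stripped off.
    by_cases h : ∀ i : ℕ+, w⁻¹ (i : ℤ) < w⁻¹ (i + 1)
    · exfalso
      have hmono : ∀ a b : ℤ, 1 ≤ a → a < b → w⁻¹ a < w⁻¹ b := by
        intro a b ha hab
        induction b, hab using Int.leInduction with
        | base => exact h ⟨a.toNat, by omega⟩ |> fun h => by simpa [Int.toNat_of_nonneg (by omega : 0 ≤ a)] using h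
        | succ b hb ihb =>
          refine ihb.trans ?_
          exact h ⟨b.toNat, by omega⟩ |> fun h => by simpa [Int.toNat_of_nonneg (by omega : 0 ≤ b)] using h
      have hw' := inv_mem_SInfty hw
      have h1 : w⁻¹ = 1 := by
        ext i
        by_cases hi : i < 1
        · simp [apply_of_nonpos hw' hi]
        · refine apply_eq_self_of_inversions hw'.1 (n := 0) ?_ (by omega : 0 < i)
          rintro ⟨a, b⟩ ⟨h2, h3⟩
          dsimp only at h2 h3 ⊢
          by_contra hb
          by_cases ha : 1 ≤ a
          · have := hmono a b ha h2
            omega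
          · have := apply_of_nonpos hw' (by omega : a < 1)
            have := one_le_apply hw' (by omega : 1 ≤ b)
            omega
      rw [inv_eq_one] at h1
      rw [h1, permLength_one] at hk
      omega
    · push Not at h
      obtain ⟨i, hi⟩ := h
      have hm := mul_mem_SInfty (simpleTransposition_mem_SInfty i) hw
      have h1 := permLength_simpleTransposition_mul hm.1
        (simpleTransposition_mul_inv_lt (not_lt.2 hi))
      rw [simpleTransposition_mul_self_mul] at h1
      obtain ⟨l, hl1, hl2⟩ := ih hm (by omega)
      refine ⟨i :: l, ?_, by rw [List.length_cons, hl2, h1]⟩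
      rw [List.map_cons, List.prod_cons, hl1, simpleTransposition_mul_self_mul]

/-! ### Localization -/

theorem finprod_inversions_ne_zero {w : Equiv.Perm ℤ} {y : ℤ → ℤ} (hy : y.Injective) :
    ∏ᶠ p ∈ inversions w, (y (w p.1) - y (w p.2)) ≠ 0 := by
  refine finprod_mem_induction (· ≠ 0) one_ne_zero (fun _ _ => mul_ne_zero) fun p hp => ?_
  rw [sub_ne_zero]
  intro h
  exact hp.1.ne (w.injective (hy h))

theorem eval_swapVars (i : ℕ+) (y : ℤ → ℤ) (f : MvPolynomial ℕ+ ℤ) :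
    eval (fun j : ℕ+ => y j) (swapVars i f) =
      eval (fun j : ℕ+ => y (simpleTransposition i j)) f := by
  rw [swapVars, eval_rename]
  congr 2
  funext j
  simp only [Function.comp_apply, simpleTransposition, Equiv.swap_apply_def]
  congr 1
  have e : ((i + 1 : ℕ+) : ℤ) = (i : ℤ) + 1 := by push_cast; rfl
  have e1 : ∀ k : ℕ+, (j : ℤ) = k ↔ j = k := fun k => by norm_cast
  simp only [← e, e1]
  split_ifs <;> rfl

/-- If `f` vanishes at all points `y ∘ u` with `ℓ(u)` less than the length of the word `l`, then
only the leading term of `∂_l` contributes to the value of `∂_l f` at `y`. -/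
theorem eval_dividedDifferenceWord_mul (l : List ℕ+) (f : MvPolynomial ℕ+ ℤ) {y : ℤ → ℤ}
    (hy : y.Injective)
    (h : ∀ u ∈ SInfty, permLength u < l.length → eval (fun j : ℕ+ => y (u j)) f = 0) :
    eval (fun j : ℕ+ => y j) (dividedDifferenceWord l f) *
      ∏ᶠ p ∈ inversions (wordProd l), (y (wordProd l p.1) - y (wordProd l p.2)) =
      eval (fun j : ℕ+ => y (wordProd l j)) f := by
  induction l generalizing y with
  | nil =>
    have h1 : inversions (wordProd []) = ∅ := by
      have := permLength_one
      rwa [permLength_eq_ncard, Set.ncard_eq_zero (inversions_finite one_mem_SInfty.1)] at this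
    rw [h1, finprod_mem_empty, mul_one]
    rfl
  | cons i l ih =>
    have hlen := permLength_wordProd_le l
    have hv := wordProd_mem_SInfty l
    rw [List.length_cons] at h
    rw [wordProd_cons, dividedDifferenceWord_cons]
    set v := wordProd l with hvdef
    set g := dividedDifferenceWord l f with hg
    -- The vanishing hypothesis reaches one length further than `l` needs, so it covers `v` itself
    -- and `g` vanishes at `y`: only the term `s_i g` of `∂_i g` contributes.
    have hg0 : eval (fun j : ℕ+ => y j) g = 0 := by
      have h1 := ih hy fun u hu hul => h u hu (by omega)
      rw [h v hv (by omega)] at h1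
      exact (mul_eq_zero.1 h1).resolve_right (finprod_inversions_ne_zero hy)
    have hsp := congrArg (eval (fun j : ℕ+ => y j)) (dividedDifference_spec i g)
    rw [map_sub, hg0, eval_swapVars, map_mul, map_sub, eval_X, eval_X, zero_sub] at hsp
    have hcast : ((i + 1 : ℕ+) : ℤ) = (i : ℤ) + 1 := by push_cast; rfl
    rw [hcast] at hsp
    have h2 := ih (y := y ∘ simpleTransposition i) (hy.comp (Equiv.injective _)) fun u hu hul => by
      have h3 := permLength_simpleTransposition_mul_le i hu
      exact h (simpleTransposition i * u)
        (mul_mem_SInfty (simpleTransposition_mem_SInfty i) hu) (by omega)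
    simp only [Function.comp_apply] at h2
    -- If `s_i v` is longer, its new inversion supplies the factor `y(i+1) - y(i)`, which cancels
    -- the denominator of `∂_i`. If it is shorter, the hypothesis applies to `s_i v` and both sides
    -- vanish.
    by_cases hlt : v⁻¹ (i : ℤ) < v⁻¹ (i + 1)
    · rw [inversions_simpleTransposition_mul hlt,
        finprod_mem_insert _ notMem_inversions (inversions_finite hv.1)]
      simp only [Equiv.Perm.mul_apply, perm_apply_inv_apply]
      rw [← h2]
      have e1 : simpleTransposition (i : ℤ) i = i + 1 := Equiv.swap_apply_left _ _
      have e2 : simpleTransposition (i : ℤ) (i + 1) = i := Equiv.swap_apply_right _ _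
      rw [e1, e2]
      linear_combination (∏ᶠ p ∈ inversions v, (y (simpleTransposition (i : ℤ) (v p.1)) -
        y (simpleTransposition (i : ℤ) (v p.2)))) * hsp
    · have hlt' := simpleTransposition_mul_inv_lt hlt
      have hm := mul_mem_SInfty (simpleTransposition_mem_SInfty i) hv
      have h3 := permLength_simpleTransposition_mul hm.1 hlt'
      rw [simpleTransposition_mul_self_mul] at h3
      have h4 := h _ hm (by omega)
      rw [h4]
      simp only [Equiv.Perm.mul_apply] at h4
      rw [h4] at h2
      have h5 := (mul_eq_zero.1 h2).resolve_right
        (finprod_inversions_ne_zero (hy.comp (Equiv.injective (simpleTransposition (i : ℤ)))))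
      rw [h5, neg_zero, eq_comm, mul_eq_zero, sub_eq_zero] at hsp
      rw [hsp.resolve_left fun h => by have := hy h; omega, zero_mul]

section Injections

variable {ι : Type*} {D : Finset ι} {κ : ι → ℤ × ℤ} {u : Equiv.Perm ℤ}

theorem card_le_permLength (hu : u ∈ SInt) (h : ∀ d ∈ D, κ d ∈ inversions u)
    (hinj : Set.InjOn κ D) : D.card ≤ permLength u := by
  rw [permLength_eq_ncard, ← Set.ncard_coe_finset, ← hinj.ncard_image]
  exact Set.ncard_le_ncard (Set.image_subset_iff.2 h) (inversions_finite hu)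

theorem image_eq_inversions (hu : u ∈ SInt) (h : ∀ d ∈ D, κ d ∈ inversions u)
    (hinj : Set.InjOn κ D) (hcard : permLength u ≤ D.card) : κ '' D = inversions u := by
  refine Set.eq_of_subset_of_ncard_le (Set.image_subset_iff.2 h) ?_ (inversions_finite hu)
  rwa [hinj.ncard_image, Set.ncard_coe_finset]

end Injections

/-- If the factors of the nonzero values of `f` at `y ∘ u` correspond to inversions of `u`, then
`∂_l f` takes only the values `0` and `1` at `y`, for words `l` of the appropriate length. -/
theorem eval_dividedDifferenceWord_eq_one {ι : Type*} {D : Finset ι} {f : MvPolynomial ℕ+ ℤ}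
    {y : ℤ → ℤ} (hy : y.Injective) (κ : Equiv.Perm ℤ → ι → ℤ × ℤ)
    (hκ : ∀ u ∈ SInfty, eval (fun j : ℕ+ => y (u j)) f ≠ 0 →
      (∀ d ∈ D, κ u d ∈ inversions u) ∧ Set.InjOn (κ u) D ∧
      eval (fun j : ℕ+ => y (u j)) f = ∏ d ∈ D, (y (u (κ u d).1) - y (u (κ u d).2)))
    {l : List ℕ+} (hl : l.length = D.card)
    (hne : eval (fun j : ℕ+ => y (wordProd l j)) f ≠ 0) :
    eval (fun j : ℕ+ => y j) (dividedDifferenceWord l f) = 1 := by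
  have hv := wordProd_mem_SInfty l
  obtain ⟨h1, h2, h3⟩ := hκ _ hv hne
  have h4 := eval_dividedDifferenceWord_mul l f hy fun u hu hul => by
    by_contra h
    obtain ⟨h1, h2, -⟩ := hκ u hu h
    have := card_le_permLength hu.1 h1 h2
    omega
  -- As `ℓ(v) ≤ |l| = |D|`, the injection `κ v` exhausts the inversions of `v`, so the inversion
  -- product is the value of `f` itself and cancels.
  have h5 := image_eq_inversions hv.1 h1 h2 (hl ▸ permLength_wordProd_le l)
  rw [← h5, finprod_mem_image h2, finprod_mem_coe_finset, ← h3] at h4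
  exact mul_right_cancel₀ hne (by rw [h4, one_mul])

/-- Counting inversions gives the vanishing needed for localization, and the inversion product is
never zero. No formula for the values of `f` is required here. -/
theorem eval_dividedDifferenceWord_eq_zero {ι : Type*} {D : Finset ι} {f : MvPolynomial ℕ+ ℤ}
    {y : ℤ → ℤ} (hy : y.Injective) (κ : Equiv.Perm ℤ → ι → ℤ × ℤ)
    (hκ : ∀ u ∈ SInfty, eval (fun j : ℕ+ => y (u j)) f ≠ 0 →
      (∀ d ∈ D, κ u d ∈ inversions u) ∧ Set.InjOn (κ u) D)
    {l : List ℕ+} (hl : l.length = D.card)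
    (h0 : eval (fun j : ℕ+ => y (wordProd l j)) f = 0) :
    eval (fun j : ℕ+ => y j) (dividedDifferenceWord l f) = 0 := by
  have h4 := eval_dividedDifferenceWord_mul l f hy fun u hu hul => by
    by_contra h
    obtain ⟨h1, h2⟩ := hκ u hu h
    have := card_le_permLength hu.1 h1 h2
    omega
  rw [h0] at h4
  exact (mul_eq_zero.1 h4).resolve_right (finprod_inversions_ne_zero hy)

theorem eq_C_eval_of_isHomogeneous_zero {σ R : Type*} [CommSemiring R] {f : MvPolynomial σ R}
    (hf : f.IsHomogeneous 0) (y : σ → R) : f = C (eval y f) := by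
  have h := totalDegree_eq_zero_iff_eq_C.1 ((totalDegree_zero_iff_isHomogeneous σ).2 hf)
  rw [h, eval_C]

/-! ### The staircase -/

theorem exists_pnat_eq {i : ℤ} (hi : 1 ≤ i) : ∃ k : ℕ+, (k : ℤ) = i :=
  ⟨⟨i.toNat, by omega⟩, Int.toNat_of_nonneg (by omega)⟩

/-- The boxes `(i, j)` with `i + j ≤ n`. -/
def staircase (n : ℕ+) : Finset (ℕ+ × ℕ+) :=
  (Finset.Icc 1 n ×ˢ Finset.Icc 1 n).filter fun p => p.1 + p.2 ≤ n

theorem mem_staircase {n : ℕ+} {p : ℕ+ × ℕ+} : p ∈ staircase n ↔ (p.1 : ℤ) + p.2 ≤ n := by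
  have h1 := p.1.pos
  have h2 := p.2.pos
  simp only [staircase, Finset.mem_filter, Finset.mem_product, Finset.mem_Icc,
    ← PNat.coe_le_coe, PNat.add_coe, PNat.one_coe]
  omega

theorem staircaseMonomial_eq_prod (n : ℕ+) :
    staircaseMonomial n = ∏ p ∈ staircase n, X p.1 := by
  rw [staircase, Finset.prod_filter, Finset.prod_product, staircaseMonomial]
  refine Finset.prod_congr rfl fun i hi => ?_
  dsimp only
  rw [← Finset.prod_filter, Finset.prod_const]
  congr 1
  have h : ((Finset.Icc 1 n).filter (fun j => i + j ≤ n)).map ⟨PNat.val, PNat.coe_injective⟩ =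
      Finset.Icc 1 ((n : ℕ) - i) := by
    ext j
    simp only [Finset.mem_map, Finset.mem_filter, Finset.mem_Icc, ← PNat.coe_le_coe, PNat.one_coe,
      PNat.add_coe, Function.Embedding.coeFn_mk]
    constructor
    · rintro ⟨k, hk, rfl⟩
      omega
    · intro hj
      exact ⟨⟨j, hj.1⟩, by simp only [PNat.mk_coe]; omega, rfl⟩
  rw [← Finset.card_map, h, Nat.card_Icc, Nat.add_sub_cancel]

theorem isHomogeneous_staircaseMonomial (n : ℕ+) :
    (staircaseMonomial n).IsHomogeneous (staircase n).card := by
  rw [staircaseMonomial_eq_prod, Finset.card_eq_sum_ones]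
  exact IsHomogeneous.prod _ _ _ fun p _ => isHomogeneous_X _ _

theorem totalDegree_prod_X_sub_C_le {σ ι R : Type*} [CommRing R] [Nontrivial R] (s : Finset ι)
    (x : ι → σ) (c : ι → R) :
    (∏ i ∈ s, (X (x i) - C (c i)) : MvPolynomial σ R).totalDegree ≤ s.card := by
  refine (totalDegree_finsetProd _ _).trans ?_
  rw [Finset.card_eq_sum_ones]
  refine Finset.sum_le_sum fun i _ => (totalDegree_sub _ _).trans ?_
  simp

theorem totalDegree_prod_X_sub_C_sub_prod_X_lt {σ ι R : Type*} [CommRing R] [Nontrivial R]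
    {s : Finset ι} (hs : s.Nonempty) (x : ι → σ) (c : ι → R) :
    (∏ i ∈ s, (X (x i) - C (c i)) - ∏ i ∈ s, X (x i) : MvPolynomial σ R).totalDegree <
      s.card := by
  classical
  induction hs using Finset.Nonempty.cons_induction with
  | singleton a => simp
  | cons a s ha hs ih =>
    rw [Finset.prod_cons, Finset.prod_cons, Finset.card_cons]
    have h : (X (x a) - C (c a)) * ∏ i ∈ s, (X (x i) - C (c i)) - X (x a) * ∏ i ∈ s, X (x i) =
        X (x a) * (∏ i ∈ s, (X (x i) - C (c i)) - ∏ i ∈ s, X (x i)) -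
          C (c a) * ∏ i ∈ s, (X (x i) - C (c i)) := by ring
    rw [h]
    refine (totalDegree_sub _ _).trans_lt (max_lt ?_ ?_)
    · refine (totalDegree_mul _ _).trans_lt ?_
      rw [totalDegree_X]
      omega
    · refine (totalDegree_mul _ _).trans_lt ?_
      have := totalDegree_prod_X_sub_C_le s x c
      rw [totalDegree_C]
      omega

/-- The product of the `x_i - j` over the staircase, which has leading term `x^{δ_n}`. -/
noncomputable def staircaseProduct (n : ℕ+) : MvPolynomial ℕ+ ℤ :=
  ∏ p ∈ staircase n, (X p.1 - C (p.2 : ℤ))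

/-- The two polynomials differ in lower degree only. The inhomogeneous one is preferred because its
zeros at the points `u` single out `w_n`. -/
theorem dividedDifferenceWord_staircaseProduct {n : ℕ+} {l : List ℕ+}
    (hl : l.length = (staircase n).card) :
    dividedDifferenceWord l (staircaseProduct n) =
      dividedDifferenceWord l (staircaseMonomial n) := by
  rw [← sub_eq_zero, ← map_sub, staircaseMonomial_eq_prod, staircaseProduct]
  rcases (staircase n).eq_empty_or_nonempty with h | h
  · simp [h]
  · apply dividedDifferenceWord_eq_zero_of_totalDegree_lt
    rw [hl]
    exact totalDegree_prod_X_sub_C_sub_prod_X_lt h _ _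

theorem eval_staircaseProduct (n : ℕ+) (u : Equiv.Perm ℤ) :
    eval (fun j : ℕ+ => id (u j)) (staircaseProduct n) =
      ∏ p ∈ staircase n, (u p.1 - p.2) := by
  simp [staircaseProduct, map_prod]

theorem eval_staircaseProduct_ne_zero_iff {n : ℕ+} {u : Equiv.Perm ℤ} :
    eval (fun j : ℕ+ => id (u j)) (staircaseProduct n) ≠ 0 ↔
      ∀ i j : ℤ, 1 ≤ i → 1 ≤ j → i + j ≤ n → u i ≠ j := by
  rw [eval_staircaseProduct, Finset.prod_ne_zero_iff]
  constructor
  · intro h i j hi hj hij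
    obtain ⟨i, rfl⟩ := exists_pnat_eq hi
    obtain ⟨j, rfl⟩ := exists_pnat_eq hj
    exact sub_ne_zero.1 (h (i, j) (mem_staircase.2 hij))
  · rintro h ⟨i, j⟩ hp
    have h1 := i.pos
    have h2 := j.pos
    exact sub_ne_zero.2 (h i j (by omega) (by omega) (mem_staircase.1 hp))

/-- If the position of the value `j` were at most `i`, or the value at `i` at most `j`, a forbidden
incidence `u a = b` with `a + b ≤ n` would result. -/
theorem staircase_mem_inversions {n : ℕ+} {u : Equiv.Perm ℤ} (hu : u ∈ SInfty)
    (h : ∀ i j : ℤ, 1 ≤ i → 1 ≤ j → i + j ≤ n → u i ≠ j) {p : ℕ+ × ℕ+} (hp : p ∈ staircase n) :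
    ((p.1 : ℤ), u⁻¹ (p.2 : ℤ)) ∈ inversions u := by
  have h1 := p.1.pos
  have h2 := p.2.pos
  rw [mem_staircase] at hp
  rw [mem_inversions, perm_apply_inv_apply]
  have h3 := one_le_apply hu (i := p.1) (by omega)
  have h4 := one_le_apply (inv_mem_SInfty hu) (i := p.2) (by omega)
  constructor
  · by_contra hc
    exact h _ _ h4 (by omega) (by omega) (perm_apply_inv_apply u p.2)
  · by_contra hc
    exact h p.1 _ (by omega) h3 (by omega) rfl

theorem staircase_injOn (n : ℕ+) (u : Equiv.Perm ℤ) :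
    Set.InjOn (fun p : ℕ+ × ℕ+ => ((p.1 : ℤ), u⁻¹ (p.2 : ℤ))) (staircase n) := by
  rintro ⟨a, b⟩ - ⟨c, d⟩ - h
  simp only [Prod.mk.injEq] at h ⊢
  exact ⟨by exact_mod_cast h.1, by exact_mod_cast (u⁻¹).injective h.2⟩

theorem reversePerm_apply (n : ℕ+) (i : ℤ) :
    reversePerm n i = if 1 ≤ i ∧ i ≤ (n : ℤ) then (n : ℤ) + 1 - i else i := rfl

/-- By the count, every inversion `(a, b)` comes from a box, so `a + u b ≤ n`. If `u i > n + 1 - i`,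
the value `n + 1 - i` sits to the right of `i` and gives an inversion with sum `n + 1`. -/
theorem eq_reversePerm {n : ℕ+} {u : Equiv.Perm ℤ} (hu : u ∈ SInfty)
    (h : ∀ i j : ℤ, 1 ≤ i → 1 ≤ j → i + j ≤ n → u i ≠ j)
    (hlen : permLength u ≤ (staircase n).card) : u = reversePerm n := by
  have himg := image_eq_inversions hu.1 (fun p hp => staircase_mem_inversions hu h hp)
    (staircase_injOn n u) hlen
  have hinv : ∀ a b, (a, b) ∈ inversions u → a + u b ≤ n ∧ 1 ≤ a := by
    intro a b hab
    rw [← himg] at hab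
    obtain ⟨p, hp, hp'⟩ := hab
    rw [Prod.mk.injEq] at hp'
    have h1 := p.1.pos
    have := mem_staircase.1 hp
    rw [← hp'.1, ← hp'.2, perm_apply_inv_apply]
    exact ⟨this, by omega⟩
  have hge : ∀ i : ℤ, 1 ≤ i → i ≤ n → n + 1 - i ≤ u i := by
    intro i h1 h2
    by_contra hc
    exact h i (u i) h1 (one_le_apply hu h1) (by omega) rfl
  have heq : ∀ i : ℤ, 1 ≤ i → i ≤ n → u i = n + 1 - i := by
    intro i h1 h2
    by_contra hc
    have h3 := hge i h1 h2
    obtain ⟨b, hb⟩ : ∃ b, u b = n + 1 - i := ⟨_, perm_apply_inv_apply u _⟩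
    have hb1 : 1 ≤ b := by
      by_contra hb1
      have := apply_of_nonpos hu (by omega : b < 1)
      omega
    have hbi : i < b := by
      by_contra hbi
      rcases (not_lt.1 hbi).lt_or_eq with h4 | h4
      · have := hge b hb1 (by omega)
        omega
      · rw [h4] at hb
        omega
    have := (hinv i b ⟨hbi, by dsimp only; omega⟩).1
    omega
  ext i
  rw [reversePerm_apply]
  split_ifs with hi
  · exact heq i hi.1 hi.2
  · by_cases h0 : i < 1
    · exact apply_of_nonpos hu h0
    · refine apply_eq_self_of_inversions hu.1 (n := n) ?_ (by omega)
      rintro ⟨a, b⟩ hab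
      have h1 := hinv a b hab
      obtain ⟨hab1, hab2⟩ := hab
      dsimp only at hab1 hab2 ⊢
      by_contra hb
      have h2 := one_le_apply hu (i := b) (by omega)
      -- The value `u b` is below `n`, and values in that range are already taken at the position `c
      -- ≤ n`.
      obtain ⟨c, hc⟩ : ∃ c, c = n + 1 - u b := ⟨_, rfl⟩
      have h3 := heq c (by omega) (by omega)
      have h4 : u c = u b := by omega
      have := u.injective h4
      omega

theorem dividedDifferenceWord_staircaseMonomial_eq_C {n : ℕ+} {l : List ℕ+}
    (hl : l.length = (staircase n).card) :
    dividedDifferenceWord l (staircaseMonomial n) =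
      C (eval (fun j : ℕ+ => id (j : ℤ)) (dividedDifferenceWord l (staircaseProduct n))) := by
  rw [dividedDifferenceWord_staircaseProduct hl]
  refine eq_C_eval_of_isHomogeneous_zero (isHomogeneous_dividedDifferenceWord ?_) _
  rw [hl]
  exact isHomogeneous_staircaseMonomial n

theorem dividedDifferenceWord_staircaseMonomial_of_eq {n : ℕ+} {l : List ℕ+}
    (hl : l.length = (staircase n).card) (h : wordProd l = reversePerm n) :
    dividedDifferenceWord l (staircaseMonomial n) = 1 := by
  rw [dividedDifferenceWord_staircaseMonomial_eq_C hl,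
    eval_dividedDifferenceWord_eq_one Function.injective_id
      (fun u p => ((p.1 : ℤ), u⁻¹ (p.2 : ℤ))) ?_ hl ?_, C_1]
  · intro u hu hne
    refine ⟨fun p hp => staircase_mem_inversions hu (eval_staircaseProduct_ne_zero_iff.1 hne) hp,
      staircase_injOn n u, ?_⟩
    rw [eval_staircaseProduct]
    simp only [perm_apply_inv_apply, id]
  · rw [h, eval_staircaseProduct_ne_zero_iff]
    intro i j hi hj hij
    rw [reversePerm_apply, if_pos (by omega)]
    omega

theorem dividedDifferenceWord_staircaseMonomial_of_ne {n : ℕ+} {l : List ℕ+}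
    (hl : l.length = (staircase n).card) (h : wordProd l ≠ reversePerm n) :
    dividedDifferenceWord l (staircaseMonomial n) = 0 := by
  rw [dividedDifferenceWord_staircaseMonomial_eq_C hl,
    eval_dividedDifferenceWord_eq_zero Function.injective_id
      (fun u p => ((p.1 : ℤ), u⁻¹ (p.2 : ℤ))) ?_ hl ?_, C_0]
  · intro u hu hne
    exact ⟨fun p hp => staircase_mem_inversions hu (eval_staircaseProduct_ne_zero_iff.1 hne) hp,
      staircase_injOn n u⟩
  · by_contra hne
    exact h (eq_reversePerm (wordProd_mem_SInfty l) (eval_staircaseProduct_ne_zero_iff.1 hne)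
      (hl ▸ permLength_wordProd_le l))

/-! ### Schubert polynomials -/

theorem inv_mem_SFin {n : ℕ+} {w : Equiv.Perm ℤ} (hw : w ∈ SFin n) : w⁻¹ ∈ SFin n :=
  fun i hi => hw i fun h => hi (Equiv.Perm.inv_eq_iff_eq.2 h.symm)

theorem reversePerm_mem_SFin (n : ℕ+) : reversePerm n ∈ SFin n := by
  intro i hi
  by_contra h
  exact hi (by rw [reversePerm_apply, if_neg h])

theorem apply_mem_Icc_iff {n : ℕ+} {w : Equiv.Perm ℤ} (hw : w ∈ SFin n) (i : ℤ) :
    (1 ≤ w i ∧ w i ≤ n) ↔ (1 ≤ i ∧ i ≤ n) := by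
  by_cases h : w i = i
  · rw [h]
  · exact iff_of_true (hw _ fun h' => h (w.injective h')) (hw i h)

theorem inversions_subset_of_mem_SFin {n : ℕ+} {w : Equiv.Perm ℤ} (hw : w ∈ SFin n) {a b : ℤ}
    (h : (a, b) ∈ inversions w) : 1 ≤ a ∧ b ≤ n := by
  obtain ⟨h1, h2⟩ := h
  dsimp only at h1 h2
  have ha := apply_mem_Icc_iff hw a
  have hb := apply_mem_Icc_iff hw b
  have ha' := hw a
  have hb' := hw b
  by_cases h3 : w a = a <;> by_cases h4 : w b = b
  · omega
  · have := hb' h4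
    omega
  · have := ha' h3
    omega
  · exact ⟨(ha' h3).1, (hb' h4).2⟩

theorem mul_mem_SFin {n : ℕ+} {v w : Equiv.Perm ℤ} (hv : v ∈ SFin n) (hw : w ∈ SFin n) :
    v * w ∈ SFin n := by
  intro i hi
  by_cases h : w i = i
  · refine hv i fun h' => hi ?_
    rw [Equiv.Perm.mul_apply, h, h']
  · exact hw i h

/-- The inversions of `w⁻¹ w_n` correspond to the non-inversions of `w` in `[n]`, through `(a, b) ↦
(w_n w b, w_n w a)`. -/
theorem permLength_inv_mul_reversePerm {n : ℕ+} {w : Equiv.Perm ℤ} (hw : w ∈ SFin n) :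
    permLength (w⁻¹ * reversePerm n) + permLength w = (staircase n).card := by
  set T : Set (ℤ × ℤ) := {p | 1 ≤ p.1 ∧ p.1 < p.2 ∧ p.2 ≤ n} with hT
  have hTfin : T.Finite := ((Set.finite_Icc (1 : ℤ) n).prod (Set.finite_Icc (1 : ℤ) n)).subset (by
    rintro ⟨a, b⟩ ⟨h1, h2, h3⟩
    simp only [Set.mem_prod, Set.mem_Icc] at *
    omega)
  have hTcard : T.ncard = (staircase n).card := by
    have h : T = (fun p : ℕ+ × ℕ+ => ((p.1 : ℤ), (n : ℤ) + 1 - p.2)) '' (staircase n) := by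
      ext ⟨a, b⟩
      constructor
      · rintro ⟨h1, h2, h3⟩
        dsimp only at h1 h2 h3
        obtain ⟨a, rfl⟩ := exists_pnat_eq h1
        obtain ⟨c, hc⟩ := exists_pnat_eq (by omega : 1 ≤ n + 1 - b)
        refine ⟨(a, c), mem_staircase.2 ?_, ?_⟩
        · dsimp only; omega
        · rw [Prod.mk.injEq]; dsimp only; omega
      · rintro ⟨p, hp, hp'⟩
        have h1 := p.1.pos
        have h2 := p.2.pos
        have h3 := mem_staircase.1 hp
        rw [Prod.mk.injEq] at hp'
        change 1 ≤ a ∧ a < b ∧ b ≤ n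
        omega
    rw [h, Set.ncard_image_of_injective, Set.ncard_coe_finset]
    rintro ⟨a, b⟩ ⟨c, d⟩ h
    simp only [Prod.mk.injEq] at h ⊢
    have h1 : (b : ℤ) = d := by omega
    exact ⟨by exact_mod_cast h.1, by exact_mod_cast h1⟩
  have hsub : inversions w ⊆ T := by
    rintro ⟨a, b⟩ hab
    have := inversions_subset_of_mem_SFin hw hab
    exact ⟨this.1, hab.1, this.2⟩
  have hrr : ∀ i, reversePerm n (reversePerm n i) = i := fun i => by
    simp only [reversePerm_apply]
    split_ifs <;> omega
  have himg : inversions (w⁻¹ * reversePerm n) =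
      (fun p : ℤ × ℤ => (reversePerm n (w p.2), reversePerm n (w p.1))) '' (T \ inversions w) := by
    ext ⟨c, d⟩
    constructor
    · intro hcd
      have h1 := inversions_subset_of_mem_SFin
        (mul_mem_SFin (inv_mem_SFin hw) (reversePerm_mem_SFin n)) hcd
      obtain ⟨h2, h3⟩ := hcd
      simp only [Equiv.Perm.mul_apply] at h2 h3
      refine ⟨(w⁻¹ (reversePerm n d), w⁻¹ (reversePerm n c)), ⟨⟨?_, h3, ?_⟩, fun h => ?_⟩, ?_⟩
      · refine ((apply_mem_Icc_iff (inv_mem_SFin hw) _).2 ?_).1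
        exact (apply_mem_Icc_iff (reversePerm_mem_SFin n) _).2 (by omega)
      · refine ((apply_mem_Icc_iff (inv_mem_SFin hw) _).2 ?_).2
        exact (apply_mem_Icc_iff (reversePerm_mem_SFin n) _).2 (by omega)
      · have h4 := h.2
        simp only [perm_apply_inv_apply, reversePerm_apply] at h4
        rw [if_pos (by omega), if_pos (by omega)] at h4
        omega
      · simp only [perm_apply_inv_apply, hrr]
    · rintro ⟨⟨a, b⟩, ⟨⟨h1, h2, h3⟩, h4⟩, h5⟩
      simp only [Prod.mk.injEq] at h1 h2 h3 h5
      rw [mem_inversions] at h4 ⊢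
      have ha := (apply_mem_Icc_iff hw a).2 (by omega)
      have hb := (apply_mem_Icc_iff hw b).2 (by omega)
      rw [← h5.1, ← h5.2]
      simp only [Equiv.Perm.mul_apply, hrr, perm_inv_apply_apply]
      refine ⟨?_, h2⟩
      rw [reversePerm_apply, if_pos hb, reversePerm_apply, if_pos ha]
      have h6 : w a ≠ w b := fun h => h2.ne (w.injective h)
      omega
  rw [permLength_eq_ncard, permLength_eq_ncard, himg, Set.ncard_image_of_injective,
    Set.ncard_sdiff_add_ncard_of_subset hsub hTfin, hTcard]
  rintro ⟨a, b⟩ ⟨c, d⟩ h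
  simp only [Prod.mk.injEq, EmbeddingLike.apply_eq_iff_eq] at h ⊢
  exact ⟨h.2, h.1⟩

/-- This isolates all that is used about the chosen `n` and reduced word, so independence of these
choices is never needed. -/
theorem exists_schubert_eq {w : Equiv.Perm ℤ} (hw : w ∈ SInfty) :
    ∃ (n : ℕ+) (l : List ℕ+), wordProd l = w⁻¹ * reversePerm n ∧
      l.length + permLength w = (staircase n).card ∧
      schubert w = dividedDifferenceWord l (staircaseMonomial n) := by
  have hn := (exists_mem_SFin hw).choose_spec
  have hex := exists_isReducedWord
    (mem_SInfty_of_mem_SFin (mul_mem_SFin (inv_mem_SFin hn) (reversePerm_mem_SFin _)))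
  refine ⟨(exists_mem_SFin hw).choose, hex.choose, hex.choose_spec.1, ?_, ?_⟩
  · rw [hex.choose_spec.2]
    exact permLength_inv_mul_reversePerm hn
  · rw [schubert, dif_pos hw, dividedDifferencePerm, dif_pos hex, dividedDifferenceWord_eq_foldr]

theorem isHomogeneous_schubert {w : Equiv.Perm ℤ} (hw : w ∈ SInfty) :
    (schubert w).IsHomogeneous (permLength w) := by
  obtain ⟨n, l, -, hlen, h⟩ := exists_schubert_eq hw
  rw [h]
  apply isHomogeneous_dividedDifferenceWord
  rw [hlen]
  exact isHomogeneous_staircaseMonomial n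

/-- Appending the word that defines `𝔖_w` gives a full-length word acting on `x^{δ_n}`, whose
product is `w_n` exactly when `wordProd l = w`. -/
theorem dividedDifferenceWord_schubert_of_eq {w : Equiv.Perm ℤ} (hw : w ∈ SInfty)
    {l : List ℕ+} (hl : l.length = permLength w) (h : wordProd l = w) :
    dividedDifferenceWord l (schubert w) = 1 := by
  obtain ⟨n, l', hl', hlen, h'⟩ := exists_schubert_eq hw
  rw [h', ← dividedDifferenceWord_append]
  apply dividedDifferenceWord_staircaseMonomial_of_eq
  · rw [List.length_append]; omega
  · rw [wordProd_append, h, hl', mul_inv_cancel_left]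

theorem dividedDifferenceWord_schubert_of_ne {w : Equiv.Perm ℤ} (hw : w ∈ SInfty)
    {l : List ℕ+} (hl : l.length = permLength w) (h : wordProd l ≠ w) :
    dividedDifferenceWord l (schubert w) = 0 := by
  obtain ⟨n, l', hl', hlen, h'⟩ := exists_schubert_eq hw
  rw [h', ← dividedDifferenceWord_append]
  apply dividedDifferenceWord_staircaseMonomial_of_ne
  · rw [List.length_append]; omega
  · rw [wordProd_append, hl', ← mul_assoc]
    intro h1
    exact h (mul_inv_eq_one.1 (mul_eq_right.1 h1))

/-! ### Fixed-point-free involutions -/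

/-- The pairs `i < j` with `i + j ≤ n`. -/
def strictStaircase (n : ℕ+) : Finset (ℕ+ × ℕ+) :=
  (Finset.Icc 1 n ×ˢ Finset.Icc 1 n).filter fun p => p.1 < p.2 ∧ p.1 + p.2 ≤ n

theorem mem_strictStaircase {n : ℕ+} {p : ℕ+ × ℕ+} :
    p ∈ strictStaircase n ↔ (p.1 : ℤ) < p.2 ∧ (p.1 : ℤ) + p.2 ≤ n := by
  have h1 := p.1.pos
  have h2 := p.2.pos
  simp only [strictStaircase, Finset.mem_filter, Finset.mem_product, Finset.mem_Icc,
    ← PNat.coe_le_coe, ← PNat.coe_lt_coe, PNat.add_coe, PNat.one_coe]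
  omega

/-- The product of the `x_i + x_j` with `i < j` and `i + j ≤ n`. -/
noncomputable def fpfProduct (n : ℕ+) : MvPolynomial ℕ+ ℤ :=
  ∏ p ∈ strictStaircase n, (X p.1 + X p.2)

theorem isHomogeneous_fpfProduct (n : ℕ+) :
    (fpfProduct n).IsHomogeneous (strictStaircase n).card := by
  rw [fpfProduct, Finset.card_eq_sum_ones]
  exact IsHomogeneous.prod _ _ _ fun p _ => (isHomogeneous_X _ _).add (isHomogeneous_X _ _)

theorem fpfProduct_ne_zero (n : ℕ+) : fpfProduct n ≠ 0 := by
  refine Finset.prod_ne_zero_iff.2 fun p _ h => ?_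
  have := congrArg (eval fun _ => (1 : ℤ)) h
  simp at this

/-! ### Conjugates of `Θ` and their inversions -/

theorem thetaPerm_eq_ite (i : ℤ) : thetaPerm i = if Even i then i - 1 else i + 1 := rfl

theorem thetaPerm_thetaPerm (i : ℤ) : thetaPerm (thetaPerm i) = i := by
  simp only [thetaPerm_eq_ite, Int.even_iff]
  split_ifs <;> omega

/-- An injective function on `ℤ` which takes opposite values at `i` and `j` exactly when
`j = Θ(i)`. -/
def thetaPoint (i : ℤ) : ℤ := if Even i then 1 - 2 * i else 2 * i + 1

theorem thetaPoint_injective : Function.Injective thetaPoint := by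
  intro i j h
  simp only [thetaPoint, Int.even_iff] at h
  split_ifs at h <;> omega

theorem thetaPoint_thetaPerm (i : ℤ) : thetaPoint (thetaPerm i) = -thetaPoint i := by
  simp only [thetaPoint, thetaPerm_eq_ite, Int.even_iff]
  split_ifs <;> omega

theorem thetaPoint_add_eq_zero_iff (i j : ℤ) :
    thetaPoint i + thetaPoint j = 0 ↔ thetaPerm i = j := by
  rw [← thetaPoint_injective.eq_iff (a := thetaPerm i), thetaPoint_thetaPerm]
  omega

/-- The conjugate `u⁻¹ Θ u`. -/
def thetaConj (u : Equiv.Perm ℤ) : Equiv.Perm ℤ := u⁻¹ * thetaPerm * u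

theorem apply_thetaConj (u : Equiv.Perm ℤ) (i : ℤ) : u (thetaConj u i) = thetaPerm (u i) := by
  simp only [thetaConj, Equiv.Perm.mul_apply, perm_apply_inv_apply]

theorem thetaConj_thetaConj (u : Equiv.Perm ℤ) (i : ℤ) : thetaConj u (thetaConj u i) = i := by
  apply u.injective
  rw [apply_thetaConj, apply_thetaConj, thetaPerm_thetaPerm]

theorem thetaConj_ne (u : Equiv.Perm ℤ) (i : ℤ) : thetaConj u i ≠ i := by
  intro h
  have := apply_thetaConj u i
  rw [h, thetaPerm_eq_ite] at this
  split_ifs at this <;> omega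

theorem one_le_thetaConj {u : Equiv.Perm ℤ} (hu : u ∈ SInfty) {i : ℤ} (hi : 1 ≤ i) :
    1 ≤ thetaConj u i := by
  have h1 := one_le_apply hu hi
  refine one_le_apply (inv_mem_SInfty hu) ?_
  change 1 ≤ thetaPerm (u i)
  rw [thetaPerm_eq_ite]
  split_ifs with h
  · rw [Int.even_iff] at h
    omega
  · omega

theorem eval_fpfProduct (n : ℕ+) (u : Equiv.Perm ℤ) :
    eval (fun j : ℕ+ => thetaPoint (u j)) (fpfProduct n) =
      ∏ p ∈ strictStaircase n, (thetaPoint (u p.1) + thetaPoint (u p.2)) := by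
  simp [fpfProduct, map_prod]

theorem eval_fpfProduct_ne_zero_iff {n : ℕ+} {u : Equiv.Perm ℤ} :
    eval (fun j : ℕ+ => thetaPoint (u j)) (fpfProduct n) ≠ 0 ↔
      ∀ i j : ℤ, 1 ≤ i → i < j → i + j ≤ n → thetaConj u i ≠ j := by
  have key : ∀ i j, thetaPoint (u i) + thetaPoint (u j) ≠ 0 ↔ thetaConj u i ≠ j := by
    intro i j
    rw [Ne, thetaPoint_add_eq_zero_iff, ← apply_thetaConj, u.injective.eq_iff]
  rw [eval_fpfProduct, Finset.prod_ne_zero_iff]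
  simp only [key]
  constructor
  · intro h i j hi hj hij
    obtain ⟨i, rfl⟩ := exists_pnat_eq hi
    obtain ⟨j, rfl⟩ := exists_pnat_eq (by omega : 1 ≤ j)
    exact h (i, j) (mem_strictStaircase.2 ⟨hj, hij⟩)
  · rintro h ⟨i, j⟩ hp
    have h1 := i.pos
    have h2 := mem_strictStaircase.1 hp
    exact h i j (by omega) h2.1 h2.2

theorem le_thetaConj {n : ℕ+} {u : Equiv.Perm ℤ} (hu : u ∈ SInfty)
    (h : ∀ i j : ℤ, 1 ≤ i → i < j → i + j ≤ n → thetaConj u i ≠ j) (i : ℤ) (hi : 1 ≤ i) :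
    n + 1 - i ≤ thetaConj u i := by
  by_contra hc
  have h1 := one_le_thetaConj hu hi
  rcases lt_trichotomy i (thetaConj u i) with h2 | h2 | h2
  · exact h i _ hi h2 (by omega) rfl
  · exact thetaConj_ne u i h2.symm
  · exact h _ i h1 h2 (by omega) (thetaConj_thetaConj u i)

/-- `Θ` moves points by one only: the value at `thetaConj u i` is at most `u i + 1 ≤ u j`, and
equality with `u j` is excluded by injectivity. -/
theorem mem_inversions_of_lt_thetaConj {u : Equiv.Perm ℤ} {i j : ℤ} (h1 : j < thetaConj u i)
    (h2 : u i < u j) : (j, thetaConj u i) ∈ inversions u := by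
  refine ⟨h1, ?_⟩
  have h3 : u j ≠ u (thetaConj u i) := fun h => h1.ne (u.injective h)
  dsimp only
  rw [apply_thetaConj, thetaPerm_eq_ite] at *
  split_ifs at * <;> omega

/-- The inversion of `u` attached to a pair `p` of the strict staircase. -/
def fpfInversion (u : Equiv.Perm ℤ) (p : ℕ+ × ℕ+) : ℤ × ℤ :=
  if u p.1 < u p.2 then ((p.2 : ℤ), thetaConj u p.1) else ((p.1 : ℤ), thetaConj u p.2)

section

variable {n : ℕ+} {u : Equiv.Perm ℤ}

theorem fpfInversion_mem (h : ∀ i : ℤ, 1 ≤ i → i ≤ n → n + 1 - i ≤ thetaConj u i)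
    {p : ℕ+ × ℕ+} (hp : p ∈ strictStaircase n) : fpfInversion u p ∈ inversions u := by
  have h1 := p.1.pos
  have h2 := p.2.pos
  have h3 := mem_strictStaircase.1 hp
  have h4 := h p.1 (by omega) (by omega)
  have h5 := h p.2 (by omega) (by omega)
  rw [fpfInversion]
  split_ifs with hlt
  · exact mem_inversions_of_lt_thetaConj (by omega) hlt
  · refine mem_inversions_of_lt_thetaConj (by omega) (lt_of_le_of_ne (not_lt.1 hlt) fun h => ?_)
    have := u.injective h
    omega

theorem fpfInversion_injOn : Set.InjOn (fpfInversion u) (strictStaircase n) := by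
  rintro ⟨a, b⟩ hp ⟨c, d⟩ hq h
  have hp := (mem_strictStaircase.1 hp).1
  have hq := (mem_strictStaircase.1 hq).1
  have cast_inj : ∀ x y : ℕ+, (x : ℤ) = y → x = y := fun x y h => by exact_mod_cast h
  simp only [fpfInversion] at h hp hq
  rw [Prod.mk.injEq]
  split_ifs at h <;> simp only [Prod.mk.injEq, EmbeddingLike.apply_eq_iff_eq] at h
  · exact ⟨cast_inj _ _ h.2, cast_inj _ _ h.1⟩
  · omega
  · omega
  · exact ⟨cast_inj _ _ h.1, cast_inj _ _ h.2⟩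

/-- Passing from `i` to `thetaConj u i` negates the coordinate, which turns the sum into a
difference in either branch. -/
theorem thetaPoint_fpfInversion (p : ℕ+ × ℕ+) :
    thetaPoint (u (fpfInversion u p).1) - thetaPoint (u (fpfInversion u p).2) =
      thetaPoint (u p.1) + thetaPoint (u p.2) := by
  rw [fpfInversion]
  split_ifs <;> rw [apply_thetaConj, thetaPoint_thetaPerm] <;> ring

variable (hn : Even (n : ℕ))

/-- The image of the reverse permutation under the inclusion `F_n → F_∞`. -/
def reverseFPF (n : ℕ+) (hn : Even (n : ℕ)) : Equiv.Perm ℤ :=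
  fpfEmbed n hn (reversePerm n) (reversePerm_mem_FPFInvolutions n hn)

theorem reverseFPF_apply (i : ℤ) :
    reverseFPF n hn i = if 1 ≤ i ∧ i ≤ (n : ℤ) then (n : ℤ) + 1 - i else thetaPerm i := by
  change (if 1 ≤ i ∧ i ≤ (n : ℤ) then reversePerm n i else thetaPerm i) = _
  split_ifs with h
  · rw [reversePerm_apply, if_pos h]
  · rfl

/-- Stated over `S_ℤ` rather than `S_∞`, since minimality of atoms is tested there. -/
theorem card_le_permLength_of_thetaConj_eq (hu : u ∈ SInt) (h : thetaConj u = reverseFPF n hn) :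
    (strictStaircase n).card ≤ permLength u := by
  refine card_le_permLength hu (fun p hp => fpfInversion_mem (fun i h1 h2 => ?_) hp)
    fpfInversion_injOn
  rw [h, reverseFPF_apply, if_pos ⟨h1, h2⟩]

/-- Write `z = thetaConj u`. By the count, every inversion has the form `(a, z i)` with `a + i ≤ n`.
If `z i ≠ j` for `i + j = n + 1`, then `z i > j` and `z j > i`, so `(j, z i)` or `(i, z j)` is an
inversion violating this bound. -/
theorem thetaConj_eq_and_mem_SFin (hu : u ∈ SInfty)
    (h : ∀ i j : ℤ, 1 ≤ i → i < j → i + j ≤ n → thetaConj u i ≠ j)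
    (hlen : permLength u ≤ (strictStaircase n).card) :
    thetaConj u = reverseFPF n hn ∧ u ∈ SFin n := by
  have hge := le_thetaConj hu h
  have himg := image_eq_inversions hu.1
    (fun p hp => fpfInversion_mem (fun i hi _ => hge i hi) hp) fpfInversion_injOn hlen
  have hinv : ∀ a i, (a, thetaConj u i) ∈ inversions u → 1 ≤ a ∧ 1 ≤ i ∧ a + i ≤ n := by
    intro a i hai
    rw [← himg] at hai
    obtain ⟨p, hp, hp'⟩ := hai
    have h1 := p.1.pos
    have h2 := p.2.pos
    have h3 := mem_strictStaircase.1 hp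
    dsimp only [fpfInversion] at hp'
    split_ifs at hp' <;>
      simp only [Prod.mk.injEq, EmbeddingLike.apply_eq_iff_eq] at hp' <;> omega
  have hm := Nat.even_iff.1 hn
  have heq : ∀ i : ℤ, 1 ≤ i → i ≤ n → thetaConj u i = n + 1 - i := by
    intro i h1 h2
    by_contra hc
    have h3 := hge i h1
    set j : ℤ := n + 1 - i with hj
    have h4 := hge j (by omega)
    have h5 : thetaConj u j ≠ i := fun h5 => by
      rw [← h5, thetaConj_thetaConj] at hc
      exact hc rfl
    -- Evenness of `n` enters here: `i = n + 1 - i` is impossible.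
    have h6 : u i ≠ u j := fun h6 => by
      have := u.injective h6
      omega
    rcases lt_or_gt_of_ne h6 with h7 | h7
    · have := hinv j i (mem_inversions_of_lt_thetaConj (by omega) h7)
      omega
    · have := hinv i j (mem_inversions_of_lt_thetaConj (by omega) h7)
      omega
  have hSn : u ∈ SFin n := by
    intro i hi
    refine ⟨hu.2 i hi, ?_⟩
    by_contra hin
    refine hi (apply_eq_self_of_inversions hu.1 (n := n) ?_ (by omega))
    rintro ⟨a, b⟩ hab
    rw [← thetaConj_thetaConj u b] at hab ⊢
    have h1 := hinv a _ hab
    have h2 := heq _ h1.2.1 (by omega)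
    dsimp only
    omega
  refine ⟨?_, hSn⟩
  ext i
  rw [reverseFPF_apply]
  split_ifs with hi
  · exact heq i hi.1 hi.2
  · have hfix : ∀ j : ℤ, ¬ (1 ≤ j ∧ j ≤ n) → u j = j := fun j hj => by
      by_contra h'
      exact hj (hSn j h')
    apply u.injective
    -- As `n` is even, `Θ` preserves the complement of `[n]`, where `u` is the identity.
    rw [apply_thetaConj, hfix i hi, hfix]
    rw [thetaPerm_eq_ite]
    split_ifs with he
    · rw [Int.even_iff] at he
      omega
    · rw [Int.even_iff] at he
      omega

/-! ### Top divided differences of `fpfProduct`, and the atoms -/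

theorem dividedDifferenceWord_fpfProduct_eq_C {l : List ℕ+}
    (hl : l.length = (strictStaircase n).card) :
    dividedDifferenceWord l (fpfProduct n) =
      C (eval (fun j : ℕ+ => thetaPoint j) (dividedDifferenceWord l (fpfProduct n))) := by
  refine eq_C_eval_of_isHomogeneous_zero (isHomogeneous_dividedDifferenceWord ?_) _
  rw [hl]
  exact isHomogeneous_fpfProduct n

theorem dividedDifferenceWord_fpfProduct_of_eq {l : List ℕ+}
    (hl : l.length = (strictStaircase n).card) (h : thetaConj (wordProd l) = reverseFPF n hn) :
    dividedDifferenceWord l (fpfProduct n) = 1 := by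
  rw [dividedDifferenceWord_fpfProduct_eq_C hl,
    eval_dividedDifferenceWord_eq_one thetaPoint_injective fpfInversion ?_ hl ?_, C_1]
  · intro u hu hne
    have hge := le_thetaConj hu (eval_fpfProduct_ne_zero_iff.1 hne)
    refine ⟨fun p hp => fpfInversion_mem (fun i hi _ => hge i hi) hp, fpfInversion_injOn, ?_⟩
    simp only [eval_fpfProduct, thetaPoint_fpfInversion]
  · rw [eval_fpfProduct_ne_zero_iff, h]
    intro i j hi hj hij
    rw [reverseFPF_apply, if_pos (by omega)]
    omega

theorem dividedDifferenceWord_fpfProduct_of_ne {l : List ℕ+}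
    (hl : l.length = (strictStaircase n).card) (h : thetaConj (wordProd l) ≠ reverseFPF n hn) :
    dividedDifferenceWord l (fpfProduct n) = 0 := by
  rw [dividedDifferenceWord_fpfProduct_eq_C hl,
    eval_dividedDifferenceWord_eq_zero thetaPoint_injective fpfInversion ?_ hl ?_, C_0]
  · intro u hu hne
    have hge := le_thetaConj hu (eval_fpfProduct_ne_zero_iff.1 hne)
    exact ⟨fun p hp => fpfInversion_mem (fun i hi _ => hge i hi) hp, fpfInversion_injOn⟩
  · by_contra hne
    exact h (thetaConj_eq_and_mem_SFin hn (wordProd_mem_SInfty l)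
      (eval_fpfProduct_ne_zero_iff.1 hne) (hl ▸ permLength_wordProd_le l)).1

/-- No atom is constructed: if none were this short, all top divided differences of the nonzero
polynomial `fpfProduct n` would vanish. -/
theorem exists_thetaConj_eq :
    ∃ v ∈ SInfty, thetaConj v = reverseFPF n hn ∧ permLength v ≤ (strictStaircase n).card := by
  by_contra! hno
  refine fpfProduct_ne_zero n
    (eq_zero_of_forall_dividedDifferenceWord (isHomogeneous_fpfProduct n) fun l hl => ?_)
  refine dividedDifferenceWord_fpfProduct_of_ne hn hl fun h => ?_
  have h1 := hno _ (wordProd_mem_SInfty l) h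
  have h2 := permLength_wordProd_le l
  omega

theorem mem_fpfAtoms_reverseFPF_iff :
    u ∈ fpfAtoms (reverseFPF n hn) ↔
      u ∈ SInt ∧ thetaConj u = reverseFPF n hn ∧ permLength u = (strictStaircase n).card := by
  constructor
  · rintro ⟨h1, h2, h3⟩
    obtain ⟨v, hv, hv', hlen⟩ := exists_thetaConj_eq hn
    have h4 := card_le_permLength_of_thetaConj_eq hn h1 h2.symm
    have h5 := h3 v hv.1 hv'.symm
    exact ⟨h1, h2.symm, by omega⟩
  · rintro ⟨h1, h2, h3⟩
    refine ⟨h1, h2.symm, fun v hv hv' => ?_⟩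
    rw [h3]
    exact card_le_permLength_of_thetaConj_eq hn hv hv'.symm

theorem finite_SFin (n : ℕ+) : (SFin n).Finite := by
  have : Finite {w : Equiv.Perm ℤ // ∀ i, ¬ (i ∈ Set.Icc (1 : ℤ) n) → w i = i} :=
    Finite.of_equiv _ (Equiv.Perm.subtypeEquivSubtypePerm (· ∈ Set.Icc (1 : ℤ) n))
  have hfin : {w : Equiv.Perm ℤ | ∀ i, ¬ (i ∈ Set.Icc (1 : ℤ) n) → w i = i}.Finite := this
  refine hfin.subset fun w hw i hi => ?_
  by_contra h
  exact hi (hw i h)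

theorem fpfSchubert_reverseFPF : fpfSchubert (reverseFPF n hn) = fpfProduct n := by
  classical
  have hfin : (fpfAtoms (reverseFPF n hn) ∩ SInfty).Finite := by
    refine (finite_SFin n).subset ?_
    rintro u ⟨h1, h2⟩
    rw [mem_fpfAtoms_reverseFPF_iff] at h1
    refine (thetaConj_eq_and_mem_SFin hn h2 (fun i j hi hj hij => ?_) h1.2.2.le).2
    rw [h1.2.1, reverseFPF_apply, if_pos (by omega)]
    omega
  have hmem : ∀ u, u ∈ hfin.toFinset ↔ u ∈ SInfty ∧ thetaConj u = reverseFPF n hn ∧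
      permLength u = (strictStaircase n).card := by
    intro u
    rw [Set.Finite.mem_toFinset, Set.mem_inter_iff, mem_fpfAtoms_reverseFPF_iff]
    exact ⟨fun h => ⟨h.2, h.1.2⟩, fun h => ⟨⟨h.1.1, h.2⟩, h.1⟩⟩
  -- Atoms outside `S_∞` contribute nothing, by the default value 0 of `schubert`; those in `S_∞`
  -- lie in the finite set `S_n`.
  have hsum : fpfSchubert (reverseFPF n hn) = ∑ w ∈ hfin.toFinset, schubert w := by
    refine finsum_mem_eq_sum_of_inter_support_eq _ ?_
    rw [Set.Finite.coe_toFinset, Set.inter_assoc]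
    congr 1
    refine (Set.inter_eq_right.2 fun w hw => ?_).symm
    by_contra h
    exact hw (dif_neg h)
  rw [hsum, eq_comm, ← sub_eq_zero]
  refine eq_zero_of_forall_dividedDifferenceWord ((isHomogeneous_fpfProduct n).sub
    (IsHomogeneous.sum _ _ _ fun w hw => ?_)) fun l hl => ?_
  · obtain ⟨h1, -, h3⟩ := (hmem w).1 hw
    exact h3 ▸ isHomogeneous_schubert h1
  · have hv := wordProd_mem_SInfty l
    have hne : ∀ w ∈ hfin.toFinset, w ≠ wordProd l →
        dividedDifferenceWord l (schubert w) = 0 := by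
      intro w hw hwl
      obtain ⟨h1, -, h3⟩ := (hmem w).1 hw
      exact dividedDifferenceWord_schubert_of_ne h1 (hl.trans h3.symm) hwl.symm
    rw [map_sub, map_sum, sub_eq_zero]
    -- In the first case the lower bound on length forces `l` to be reduced, so `wordProd l` is
    -- itself an atom and only its term survives.
    by_cases hz : thetaConj (wordProd l) = reverseFPF n hn
    · have hlen : permLength (wordProd l) = (strictStaircase n).card :=
        le_antisymm (hl ▸ permLength_wordProd_le l)
          (card_le_permLength_of_thetaConj_eq hn hv.1 hz)
      rw [dividedDifferenceWord_fpfProduct_of_eq hn hl hz,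
        Finset.sum_eq_single_of_mem _ ((hmem _).2 ⟨hv, hz, hlen⟩) hne,
        dividedDifferenceWord_schubert_of_eq hv (hl.trans hlen.symm) rfl]
    · rw [dividedDifferenceWord_fpfProduct_of_ne hn hl hz]
      refine (Finset.sum_eq_zero fun w hw => hne w hw ?_).symm
      rintro rfl
      exact hz ((hmem _).1 hw).2.1

end

theorem corollary4 (n : ℕ+) (hn : Even (n : ℕ)) :
    fpfSchubert (fpfEmbed n hn (reversePerm n) (reversePerm_mem_FPFInvolutions n hn)) =
      ∏ p ∈ (Finset.Icc 1 n ×ˢ Finset.Icc 1 n).filter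
          (fun p : ℕ+ × ℕ+ => p.1 < p.2 ∧ p.1 + p.2 ≤ n),
        (MvPolynomial.X p.1 + MvPolynomial.X p.2 : MvPolynomial ℕ+ ℤ) :=
  fpfSchubert_reverseFPF hn
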